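/- Let $d,n\in\mathbb{N}=\{1,2,\dots\}$, $N:=n+1$, and let $\Omega=\{t_1,\dots,t_M\}\subset[0,1)^d$ be a set of $M<N^d$ distinct points. Write $z_j:=(e^{2\pi i (t_j)_1},\dots,e^{2\pi i (t_j)_d})$ and consider the Vandermonde matrix $$A:=\bigl(z_j^{\alpha}\bigr)_{1\le j\le M,\ \alpha\in\{0,\dots,n\}^d}\in\mathbb{C}^{M\times N^d},\qquad \sigma_{\min}(A):=\min_{v\in\mathbb{C}^M,\ \|v\|_2=1}\|A^*v\|_2 .$$ For $t,t'\in[0,1)^d$ let $|t-t'|_{\mathbb{T}}:=\min_{r\in\mathbb{Z}^d}\|t-t'+r\|_\infty$. A subset of $\Omega$ is called a cluster if, modulo $\mathbb{Z}^d$, it is contained in an axis-parallel closed cube of side length $1/N$. Suppose that $\Omega=\bigcup_{l=1}^L\Lambda_l$ is a clustered node configuration, i.e. the $\Lambda_l$ are clusters and $$\rho:=N\min_{1\le l<l'\le L}\ \min_{t\in\Lambda_l,\,t'\in\Lambda_{l'}}|t-t'|_{\mathbb{T}}>1$$ (with $\rho:=\infty$ if $L=1$). Let $\lambda:=\max_l|\Lambda_l|$,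 $$\tau:=N\min_{1\le j<j'\le M}|t_j-t_{j'}|_{\mathbb{T}},\qquad \mathcal{C}:=\max_{1\le j\le M}\ \prod_{t'\in\Omega:\ 0<|t_j-t'|_{\mathbb{T}}\le 1/N}\frac{1}{N|t_j-t'|_{\mathbb{T}}}.$$ If $\lambda=2$, then $\mathcal{C}=1/\tau$, and the condition $$\rho\ \ge\ 12\,d\left(\frac{4}{\tau}\right)^{\frac{1}{d+1}}$$ implies $$\sigma_{\min}(A)\ \ge\ \frac{\tau N^{d/2}}{12\cdot 2^{d/2-1/2}\cdot d^{d/4}} .$$ -/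

import Mathlib

noncomputable section

namespace ClusteredVandermonde

variable {d : ℕ}

/-- The wrap-around distance `min_{r ∈ ℤ^d} ‖t - t' + r‖_∞`
(`Fin d → ℝ` carries the maximum norm). -/
def wrapDist (t t' : Fin d → ℝ) : ℝ :=
  ⨅ r : Fin d → ℤ, ‖t - t' + fun i => (r i : ℝ)‖

/-- `Λ` is a cluster: modulo `ℤ^d`, it is contained in an axis-parallel closed cube of
side length `1 / N`. -/
def IsCluster (N : ℕ) (Λ : Finset (Fin d → ℝ)) : Prop :=
  ∃ a : Fin d → ℝ, ∀ t ∈ Λ, ∃ r : Fin d → ℤ, ∀ i,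
    a i ≤ t i + r i ∧ t i + r i ≤ a i + 1 / (N : ℝ)

/-- The distance of two clusters; it is extended-real valued, so that a minimum over
the empty set is `⊤`. -/
def clusterDist (Λ Λ' : Finset (Fin d → ℝ)) : EReal :=
  ⨅ t ∈ Λ, ⨅ t' ∈ Λ', (wrapDist t t' : EReal)

/-- The normalized minimal cluster separation `ρ`
(equal to `⊤` if there is only one cluster). -/
def clusterSep (N : ℕ) {L : ℕ} (Λ : Fin L → Finset (Fin d → ℝ)) : EReal :=
  (N : EReal) * ⨅ (l : Fin L) (l' : Fin L) (_ : l < l'), clusterDist (Λ l) (Λ l')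

/-- `Ω ⊆ [0,1)^d` is a clustered node configuration with clusters `Λ 0, …, Λ (L - 1)`. -/
structure IsClusteredConfiguration (N : ℕ) (Ω : Finset (Fin d → ℝ)) {L : ℕ}
    (Λ : Fin L → Finset (Fin d → ℝ)) : Prop where
  mem_Ico : ∀ t ∈ Ω, ∀ i, t i ∈ Set.Ico (0 : ℝ) 1
  eq_iUnion : (Ω : Set (Fin d → ℝ)) = ⋃ l, (Λ l : Set (Fin d → ℝ))
  isCluster : ∀ l, IsCluster N (Λ l)
  one_lt_sep : 1 < clusterSep N Λ

/-- The cardinality `λ` of the biggest cluster. -/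
def maxClusterCard {L : ℕ} (Λ : Fin L → Finset (Fin d → ℝ)) : ℕ :=
  Finset.univ.sup fun l => (Λ l).card

open Classical in
/-- The cluster complexity `𝒞`. -/
def clusterComplexity (N : ℕ) (Ω : Finset (Fin d → ℝ)) : ℝ :=
  ⨆ t : Ω, ∏ t' ∈ Ω with 0 < wrapDist (t : Fin d → ℝ) t' ∧
      wrapDist (t : Fin d → ℝ) t' ≤ 1 / (N : ℝ),
    1 / ((N : ℝ) * wrapDist (t : Fin d → ℝ) t')

/-- The normalized minimal separation `τ` of the nodes
(a minimum as soon as there are at least two nodes). -/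
def minSep (N : ℕ) (Ω : Finset (Fin d → ℝ)) : ℝ :=
  (N : ℝ) * sInf {x : ℝ | ∃ t ∈ Ω, ∃ t' ∈ Ω, t ≠ t' ∧ x = wrapDist t t'}

/-- The node `z = exp(2πi t)` on the torus belonging to `t`. -/
def node (t : Fin d → ℝ) : Fin d → ℂ :=
  fun i => Complex.exp (2 * Real.pi * Complex.I * (t i : ℂ))

/-- The multivariate Vandermonde matrix `(z^α)`, with rows indexed by the nodes and columns
by the multi-indices `α ∈ {0, …, n}^d`. -/
def vandermonde (n : ℕ) (Ω : Finset (Fin d → ℝ)) : Matrix Ω (Fin d → Fin (n + 1)) ℂ :=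
  Matrix.of fun t α => ∏ i, node (t : Fin d → ℝ) i ^ (α i : ℕ)

/-- `σ_min(A)`, the minimum of `‖A^* v‖₂` over all unit vectors `v`. -/
def sigmaMin {ι κ : Type*} [Fintype ι] [Fintype κ] (A : Matrix ι κ ℂ) : ℝ :=
  ⨅ v : {v : EuclideanSpace ℂ ι // ‖v‖ = 1},
    ‖WithLp.toLp 2 (A.conjTranspose.mulVec (WithLp.ofLp (v : EuclideanSpace ℂ ι)))‖

end ClusteredVandermonde

end

/-!
Write `N = n + 1` and let `J` be the matrix of values `∏ i, p (z_j i * conj (z_k i))` of a product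
kernel, where `p` is a polynomial with nonnegative coefficients and `p 1 = 1`: a long averaged
geometric sum times `d` short ones, so that `J` decays like the `(d + 1)`-st power of the inverse
distance. Then `J = V D Vᴴ` for a monomial matrix `V` and a diagonal `D` bounded by
`(2 / N) ^ d`, so `‖J v‖² ≤ ‖D‖ ‖J‖ ‖Vᴴ v‖²` by the C*-identity, while `‖J‖` is bounded by
Schur's test.

The kernel cannot tell a node from its partner in a cluster. To separate them, the row of the node
`z_j` is multiplied by a two-term function `a - b * conj (z i) ^ M`, equal to `1` at `z_j` and to
`0` at its partner, with `‖a‖, ‖b‖ ≤ 5 / (4 τ)` for `M ≈ N / 5`. The modulated matrix `W` is the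
identity within clusters, and the separation of the clusters bounds the remaining entries, so that
`‖W - 1‖ ≤ 1 / 2` and `‖v‖ ≤ 2 ‖W v‖`. As `p` has degree less than `N - M`, only monomials of
degree less than `N` enter `W`, whence `‖W v‖` is bounded by a multiple of `‖Aᴴ v‖`.
-/

namespace ClusteredVandermonde

section OperatorNorm

open Matrix
open scoped Matrix.Norms.L2Operator

variable {𝕜 : Type*} [RCLike 𝕜] {m n : Type*} [Fintype m] [Fintype n] [DecidableEq n]

theorem l2_opNorm_le_sqrt_of_sum_norm_le {A : Matrix m n 𝕜} {R C : ℝ} (hR : 0 ≤ R)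
    (hrow : ∀ i, ∑ j, ‖A i j‖ ≤ R) (hcol : ∀ j, ∑ i, ‖A i j‖ ≤ C) : ‖A‖ ≤ √(R * C) := by
  rw [l2_opNorm_def]
  refine ContinuousLinearMap.opNorm_le_bound _ (Real.sqrt_nonneg _) fun x => ?_
  have hentry (i : m) : ‖∑ j, A i j * x j‖ ^ 2 ≤ R * ∑ j, ‖A i j‖ * ‖x j‖ ^ 2 := by
    calc ‖∑ j, A i j * x j‖ ^ 2 ≤ (∑ j, ‖A i j‖ * ‖x j‖) ^ 2 := by
          gcongr
          exact (norm_sum_le _ _).trans_eq (Finset.sum_congr rfl fun j _ => norm_mul _ _)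
      _ ≤ (∑ j, ‖A i j‖) * ∑ j, ‖A i j‖ * ‖x j‖ ^ 2 :=
          Finset.sum_sq_le_sum_mul_sum_of_sq_le_mul _ (fun _ _ => norm_nonneg _)
            (fun _ _ => by positivity) fun j _ => by rw [mul_pow, sq ‖A i j‖, mul_assoc]
      _ ≤ R * ∑ j, ‖A i j‖ * ‖x j‖ ^ 2 := by
          gcongr
          exact hrow i
  have hsq : ‖WithLp.toLp 2 (A *ᵥ x)‖ ^ 2 ≤ R * C * ‖x‖ ^ 2 := by
    simp only [EuclideanSpace.norm_sq_eq, mulVec, dotProduct]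
    calc ∑ i, ‖∑ j, A i j * x j‖ ^ 2 ≤ ∑ i, R * ∑ j, ‖A i j‖ * ‖x j‖ ^ 2 :=
          Finset.sum_le_sum fun i _ => hentry i
      _ = R * ∑ j, (∑ i, ‖A i j‖) * ‖x j‖ ^ 2 := by
          simp only [← Finset.mul_sum, Finset.sum_mul]
          rw [Finset.sum_comm]
      _ ≤ R * ∑ j, C * ‖x j‖ ^ 2 := by
          gcongr with j
          exact hcol j
      _ = R * C * ∑ j, ‖x j‖ ^ 2 := by rw [← Finset.mul_sum, mul_assoc]
  calc ‖WithLp.toLp 2 (A *ᵥ x)‖ ≤ √(R * C * ‖x‖ ^ 2) := Real.le_sqrt_of_sq_le hsq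
    _ = √(R * C) * ‖x‖ := by rw [Real.sqrt_mul' _ (sq_nonneg _), Real.sqrt_sq (norm_nonneg x)]

theorem l2_opNorm_le_of_norm_le_symm {A : Matrix n n 𝕜} {h : n → n → ℝ} {R : ℝ} (hR : 0 ≤ R)
    (hA : ∀ i j, ‖A i j‖ ≤ h i j) (hsymm : ∀ i j, h i j = h j i) (hsum : ∀ i, ∑ j, h i j ≤ R) :
    ‖A‖ ≤ R := by
  have hcol (j : n) : ∑ i, ‖A i j‖ ≤ R :=
    (Finset.sum_le_sum fun i _ => (hA i j).trans_eq (hsymm i j)).trans (hsum j)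
  simpa only [Real.sqrt_mul_self hR] using l2_opNorm_le_sqrt_of_sum_norm_le hR
    (fun i => (Finset.sum_le_sum fun j _ => hA i j).trans (hsum i)) hcol

theorem l2_opNorm_mul_diagonal_sq_le [DecidableEq m] (V : Matrix m n 𝕜) {p : n → ℝ} {C : ℝ}
    (hp : ∀ a, 0 ≤ p a) (hpC : ∀ a, p a ≤ C) (hC : 0 ≤ C) :
    ‖V * diagonal fun a => (p a : 𝕜)‖ ^ 2 ≤ C * ‖V * (diagonal fun a => (p a : 𝕜)) * Vᴴ‖ := by
  set D : Matrix n n 𝕜 := diagonal fun a => (√(p a) : 𝕜) with hD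
  have hDD : D * D = diagonal fun a => (p a : 𝕜) := by
    rw [hD, diagonal_mul_diagonal]
    congr! 2 with a
    rw [← RCLike.ofReal_mul, Real.mul_self_sqrt (hp a)]
  have hDsa : Dᴴ = D := by
    rw [hD, diagonal_conjTranspose]
    congr! 2 with a
    exact RCLike.conj_ofReal _
  have hDnorm : ‖D‖ ≤ √C := by
    rw [hD, l2_opNorm_diagonal, pi_norm_le_iff_of_nonneg (Real.sqrt_nonneg C)]
    intro a
    rw [RCLike.norm_ofReal, abs_of_nonneg (Real.sqrt_nonneg _)]
    exact Real.sqrt_le_sqrt (hpC a)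
  have hGram : ‖V * D‖ ^ 2 = ‖V * (D * D) * Vᴴ‖ := by
    have hstar := l2_opNorm_conjTranspose_mul_self (V * D)ᴴ
    rw [conjTranspose_conjTranspose, l2_opNorm_conjTranspose] at hstar
    rw [sq, ← hstar, conjTranspose_mul, hDsa]
    simp only [Matrix.mul_assoc]
  rw [← hDD, ← Matrix.mul_assoc V D D]
  calc ‖V * D * D‖ ^ 2 ≤ (‖V * D‖ * √C) ^ 2 := by
        gcongr
        exact (l2_opNorm_mul _ _).trans (by gcongr)
    _ = C * ‖V * D * D * Vᴴ‖ := by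
        rw [mul_pow, Real.sq_sqrt hC, hGram, ← Matrix.mul_assoc, mul_comm]

theorem norm_le_two_mul_norm_mulVec {W : Matrix n n 𝕜} (hW : ‖W - 1‖ ≤ 1 / 2)
    (v : EuclideanSpace 𝕜 n) : ‖v‖ ≤ 2 * ‖WithLp.toLp 2 (W *ᵥ v)‖ := by
  have herr : ‖WithLp.toLp 2 ((W - 1) *ᵥ v)‖ ≤ 1 / 2 * ‖v‖ :=
    (l2_opNorm_mulVec (W - 1) v).trans (by gcongr)
  rw [sub_mulVec, one_mulVec, WithLp.toLp_sub, WithLp.toLp_ofLp, norm_sub_rev] at herr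
  linarith [norm_sub_norm_le v (WithLp.toLp 2 (W *ᵥ v))]

end OperatorNorm

section Polynomials

open Polynomial

theorem coeff_mul_nonneg {R : Type*} [Semiring R] [PartialOrder R] [IsOrderedRing R] {p q : R[X]}
    (hp : ∀ a, 0 ≤ p.coeff a) (hq : ∀ a, 0 ≤ q.coeff a) (a : ℕ) : 0 ≤ (p * q).coeff a := by
  rw [coeff_mul]
  exact Finset.sum_nonneg fun x _ => mul_nonneg (hp _) (hq _)

theorem coeff_pow_nonneg {R : Type*} [Semiring R] [PartialOrder R] [IsOrderedRing R] {p : R[X]}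
    (hp : ∀ a, 0 ≤ p.coeff a) (k a : ℕ) : 0 ≤ (p ^ k).coeff a := by
  induction k generalizing a with
  | zero => rw [pow_zero, coeff_one]; split_ifs <;> simp
  | succ k ih => rw [pow_succ]; exact coeff_mul_nonneg ih hp a

theorem coeff_mul_le {R : Type*} [CommSemiring R] [PartialOrder R] [IsOrderedRing R] {p q : R[X]}
    {C : R} (hC : 0 ≤ C) (hp : ∀ a, p.coeff a ≤ C) (hq : ∀ a, 0 ≤ q.coeff a) (a : ℕ) :
    (p * q).coeff a ≤ C * q.eval 1 := by
  rw [mul_comm p, coeff_mul, Finset.Nat.sum_antidiagonal_eq_sum_range_succ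
    (fun i j => q.coeff i * p.coeff j)]
  calc ∑ k ∈ Finset.range (a + 1), q.coeff k * p.coeff (a - k)
      ≤ ∑ k ∈ Finset.range (a + 1), q.coeff k * C :=
        Finset.sum_le_sum fun k _ => mul_le_mul_of_nonneg_left (hp _) (hq k)
    _ ≤ ∑ k ∈ Finset.range (max (a + 1) (q.natDegree + 1)), q.coeff k * C :=
        Finset.sum_le_sum_of_subset_of_nonneg
          (Finset.range_mono (le_max_left _ _)) fun k _ _ => mul_nonneg (hq k) hC
    _ = C * q.eval 1 := by
        rw [eval_eq_sum_range' (n := max (a + 1) (q.natDegree + 1)) (by omega), ← Finset.sum_mul,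
          mul_comm]
        simp only [one_pow, mul_one]

theorem norm_aeval_le_eval_one {A : Type*} [NormedRing A] [NormOneClass A] [NormedAlgebra ℝ A]
    {p : ℝ[X]} (hp : ∀ a, 0 ≤ p.coeff a) {ζ : A} (hζ : ‖ζ‖ ≤ 1) :
    ‖aeval ζ p‖ ≤ p.eval 1 := by
  rw [aeval_eq_sum_range, eval_eq_sum_range]
  refine norm_sum_le_of_le _ fun a _ => ?_
  rw [norm_smul, Real.norm_of_nonneg (hp a), one_pow]
  gcongr
  · exact hp a
  · exact (norm_pow_le ζ a).trans (pow_le_one₀ (norm_nonneg ζ) hζ)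

/-- The Dirichlet kernel `(1 + X + ⋯ + X ^ (m - 1)) / m`, normalized to the value `1` at `1`. -/
noncomputable def dirichletPoly (m : ℕ) : ℝ[X] :=
  C (m : ℝ)⁻¹ * ∑ i ∈ Finset.range m, X ^ i

/-- The product of a Dirichlet kernel of length `m`, which keeps the coefficients below `1 / m`, and
the `d`-th power of one of length `m'`, which makes the values decay of order `d + 1` away from
`1`. -/
noncomputable def localizer (d m m' : ℕ) : ℝ[X] :=
  dirichletPoly m * dirichletPoly m' ^ d

theorem coeff_dirichletPoly (m a : ℕ) :
    (dirichletPoly m).coeff a = if a < m then (m : ℝ)⁻¹ else 0 := by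
  simp [dirichletPoly, coeff_X_pow]

theorem coeff_dirichletPoly_nonneg (m a : ℕ) : 0 ≤ (dirichletPoly m).coeff a := by
  rw [coeff_dirichletPoly]; positivity

theorem natDegree_dirichletPoly_le (m : ℕ) : (dirichletPoly m).natDegree ≤ m - 1 := by
  refine (natDegree_C_mul_le _ _).trans (natDegree_sum_le_of_forall_le _ _ fun i hi => ?_)
  rw [natDegree_X_pow]
  exact Nat.le_sub_one_of_lt (Finset.mem_range.1 hi)

theorem eval_one_dirichletPoly {m : ℕ} (hm : 0 < m) : (dirichletPoly m).eval 1 = 1 := by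
  simp [dirichletPoly, eval_finsetSum, hm.ne']

theorem coeff_localizer_nonneg (d m m' a : ℕ) : 0 ≤ (localizer d m m').coeff a :=
  coeff_mul_nonneg (coeff_dirichletPoly_nonneg m)
    (coeff_pow_nonneg (coeff_dirichletPoly_nonneg m') d) a

theorem coeff_localizer_le (d m : ℕ) {m' : ℕ} (hm' : 0 < m') (a : ℕ) :
    (localizer d m m').coeff a ≤ 1 / m := by
  have hcoeff (b : ℕ) : (dirichletPoly m).coeff b ≤ 1 / m := by
    rw [coeff_dirichletPoly, one_div]
    split_ifs
    exacts [le_rfl, by positivity]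
  simpa only [eval_pow, eval_one_dirichletPoly hm', one_pow, mul_one, localizer] using
    coeff_mul_le (by positivity) hcoeff (coeff_pow_nonneg (coeff_dirichletPoly_nonneg m') d) a

theorem natDegree_localizer_le (d m m' : ℕ) :
    (localizer d m m').natDegree ≤ (m - 1) + d * (m' - 1) :=
  natDegree_mul_le.trans <| add_le_add (natDegree_dirichletPoly_le m) <|
    natDegree_pow_le.trans <| Nat.mul_le_mul_left d (natDegree_dirichletPoly_le m')

theorem eval_one_localizer (d : ℕ) {m m' : ℕ} (hm : 0 < m) (hm' : 0 < m') :
    (localizer d m m').eval 1 = 1 := by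
  rw [localizer, eval_mul, eval_pow, eval_one_dirichletPoly hm, eval_one_dirichletPoly hm',
    one_pow, mul_one]

end Polynomials

section Exponentials

open Polynomial
open scoped FourierTransform ComplexConjugate

theorem four_mul_abs_le_norm_fourierChar_sub_one {x : ℝ} (hx : |x| ≤ 1 / 2) :
    4 * |x| ≤ ‖(𝐞 x : ℂ) - 1‖ := by
  have hsin : 2 / Real.pi * |Real.pi * x| ≤ |Real.sin (Real.pi * x)| :=
    Real.mul_abs_le_abs_sin (by
      rw [abs_mul, abs_of_pos Real.pi_pos]
      nlinarith [Real.pi_pos])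
  have hnorm : ‖(𝐞 x : ℂ) - 1‖ = 2 * |Real.sin (Real.pi * x)| := by
    rw [Real.fourierChar_apply, mul_comm, Complex.norm_exp_I_mul_ofReal_sub_one, norm_mul,
      Real.norm_two, Real.norm_eq_abs, mul_assoc, mul_div_cancel_left₀ _ two_ne_zero]
  rw [hnorm]
  calc 4 * |x| = 2 * (2 / Real.pi * |Real.pi * x|) := by
        rw [abs_mul, abs_of_pos Real.pi_pos]
        field_simp
        ring
    _ ≤ 2 * |Real.sin (Real.pi * x)| := by gcongr

theorem fourierChar_sub_intCast (x : ℝ) (r : ℤ) : 𝐞 (x - r) = 𝐞 x := by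
  ext
  rw [Real.fourierChar_apply, Real.fourierChar_apply, Complex.exp_eq_exp_iff_exists_int]
  exact ⟨-r, by push_cast; ring⟩

theorem norm_aeval_dirichletPoly_le {x : ℝ} (hx0 : x ≠ 0) (hx : |x| ≤ 1 / 2) (m : ℕ) :
    ‖aeval (𝐞 x : ℂ) (dirichletPoly m)‖ ≤ 1 / (2 * m * |x|) := by
  have : 0 < |x| := abs_pos.2 hx0
  have hgeom : ‖∑ i ∈ Finset.range m, (𝐞 x : ℂ) ^ i‖ * (4 * |x|) ≤ 2 :=
    calc ‖∑ i ∈ Finset.range m, (𝐞 x : ℂ) ^ i‖ * (4 * |x|)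
        ≤ ‖∑ i ∈ Finset.range m, (𝐞 x : ℂ) ^ i‖ * ‖(𝐞 x : ℂ) - 1‖ := by
          gcongr
          exact four_mul_abs_le_norm_fourierChar_sub_one hx
      _ = ‖(𝐞 x : ℂ) ^ m - 1‖ := by rw [← norm_mul, geom_sum_mul]
      _ ≤ 2 := by
          refine (norm_sub_le _ _).trans_eq ?_
          rw [norm_pow, Circle.norm_coe, one_pow, norm_one, one_add_one_eq_two]
  have heval : ‖aeval (𝐞 x : ℂ) (dirichletPoly m)‖ =
      (m : ℝ)⁻¹ * ‖∑ i ∈ Finset.range m, (𝐞 x : ℂ) ^ i‖ := by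
    simp [dirichletPoly]
  calc ‖aeval (𝐞 x : ℂ) (dirichletPoly m)‖ ≤ (m : ℝ)⁻¹ * (1 / (2 * |x|)) := by
        rw [heval]
        gcongr
        rw [le_div_iff₀ (by positivity)]
        linarith
    _ = 1 / (2 * m * |x|) := by
        rw [← one_div, one_div_mul_one_div]
        ring_nf

theorem norm_aeval_localizer_le {x : ℝ} (hx0 : x ≠ 0) (hx : |x| ≤ 1 / 2) (d m m' : ℕ) :
    ‖aeval (𝐞 x : ℂ) (localizer d m m')‖ ≤ 1 / (2 * m * |x|) * (1 / (2 * m' * |x|)) ^ d := by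
  rw [localizer, map_mul, map_pow, norm_mul, norm_pow]
  gcongr <;> exact norm_aeval_dirichletPoly_le hx0 hx _

end Exponentials

section MonomialMatrix

open Matrix Polynomial
open scoped Matrix.Norms.L2Operator ComplexConjugate

variable {d : ℕ} {ι : Type*}

/-- The matrix `(z_j ^ α)` of all monomials of degree less than `K` in each variable; the
Vandermonde matrix of the nodes is the case `K = n + 1`. -/
def monomialMatrix (z : ι → Fin d → ℂ) (K : ℕ) : Matrix ι (Fin d → Fin K) ℂ :=
  of fun j α => ∏ i, z j i ^ (α i : ℕ)

/-- The kernel `∏ i, p (z_i * conj w_i)` on the torus; a convolution kernel there, as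
`conj w_i = w_i⁻¹`. -/
noncomputable def torusKernel (p : ℝ[X]) (z w : Fin d → ℂ) : ℂ :=
  ∏ i, aeval (z i * conj (w i)) p

/-- The matrix of the values of `torusKernel` at pairs of nodes. -/
noncomputable def kernelMatrix (p : ℝ[X]) (z : ι → Fin d → ℂ) : Matrix ι ι ℂ :=
  of fun j k => torusKernel p (z j) (z k)

theorem torusKernel_self {p : ℝ[X]} (hp : p.eval 1 = 1) {z : Fin d → ℂ} (hz : ∀ i, ‖z i‖ = 1) :
    torusKernel p z z = 1 := by
  refine Finset.prod_eq_one fun i _ => ?_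
  rw [Complex.mul_conj', hz, Complex.ofReal_one, one_pow, ← map_one (algebraMap ℝ ℂ),
    aeval_algebraMap_apply, aeval_def, eval₂_eq_eval_map]
  simp [hp]

theorem norm_torusKernel_comm (p : ℝ[X]) (z w : Fin d → ℂ) :
    ‖torusKernel p z w‖ = ‖torusKernel p w z‖ := by
  have hconj : torusKernel p w z = conj (torusKernel p z w) := by
    rw [torusKernel, torusKernel, map_prod]
    refine Finset.prod_congr rfl fun i _ => ?_
    rw [← aeval_conj, map_mul, Complex.conj_conj, mul_comm]
  rw [hconj, RCLike.norm_conj]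

theorem norm_torusKernel_le_one {p : ℝ[X]} (hp0 : ∀ a, 0 ≤ p.coeff a) (hp1 : p.eval 1 = 1)
    {z w : Fin d → ℂ} (hz : ∀ i, ‖z i‖ = 1) (hw : ∀ i, ‖w i‖ = 1) : ‖torusKernel p z w‖ ≤ 1 := by
  rw [torusKernel, norm_prod]
  refine Finset.prod_le_one (fun _ _ => norm_nonneg _) fun i _ =>
    hp1 ▸ norm_aeval_le_eval_one hp0 ?_
  rw [norm_mul, RCLike.norm_conj, hz, hw, one_mul]

theorem monomialMatrix_mul_diagonal_mul_conjTranspose (z : ι → Fin d → ℂ) {p : ℝ[X]} {K : ℕ}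
    (hK : p.natDegree < K) :
    monomialMatrix z K * (diagonal fun α : Fin d → Fin K => ((∏ i, p.coeff (α i) : ℝ) : ℂ)) *
      (monomialMatrix z K)ᴴ = kernelMatrix p z := by
  ext j k
  have hsum (i : Fin d) : aeval (z j i * conj (z k i)) p =
      ∑ a : Fin K, z j i ^ (a : ℕ) * p.coeff a * conj (z k i ^ (a : ℕ)) := by
    rw [aeval_eq_sum_range' hK, Finset.sum_range]
    refine Finset.sum_congr rfl fun a _ => ?_
    rw [Algebra.smul_def, mul_pow, map_pow, Complex.coe_algebraMap]
    ring
  simp only [kernelMatrix, torusKernel, of_apply, hsum, Finset.prod_univ_sum,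
    Fintype.piFinset_univ, Finset.prod_mul_distrib]
  rw [mul_apply]
  simp [mul_diagonal, monomialMatrix]

variable [Fintype ι]

theorem norm_conjTranspose_mulVec_monomial_mul_le (z : ι → Fin d → ℂ) {K N : ℕ} {β : Fin d → ℕ}
    (hβ : ∀ i, K + β i ≤ N) (v : ι → ℂ) :
    ‖WithLp.toLp 2 ((monomialMatrix z K)ᴴ *ᵥ fun j => conj (∏ i, z j i ^ β i) * v j)‖ ≤
      ‖WithLp.toLp 2 ((monomialMatrix z N)ᴴ *ᵥ v)‖ := by
  let shift (α : Fin d → Fin K) (i : Fin d) : Fin N := ⟨α i + β i, by have := hβ i; omega⟩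
  have hshift : Function.Injective shift := fun α α' h => by
    ext i
    simpa [shift] using congrFun h i
  have hentry (α : Fin d → Fin K) :
      ((monomialMatrix z K)ᴴ *ᵥ fun j => conj (∏ i, z j i ^ β i) * v j) α =
        ((monomialMatrix z N)ᴴ *ᵥ v) (shift α) := by
    simp only [mulVec, dotProduct, conjTranspose_apply, monomialMatrix, of_apply, shift, pow_add,
      Finset.prod_mul_distrib, star_mul', ← mul_assoc]
    rfl
  refine le_of_sq_le_sq ?_ (norm_nonneg _)
  simp only [EuclideanSpace.norm_sq_eq, hentry]
  exact (Finset.sum_map Finset.univ ⟨shift, hshift⟩ fun α =>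
    ‖((monomialMatrix z N)ᴴ *ᵥ v) α‖ ^ 2).symm.trans_le
      (Finset.sum_le_univ_sum_of_nonneg fun α => by positivity)

/-- The kernel matrix with its `j`-th row multiplied by the exponential polynomial
`a_j - b_j * conj z_i ^ M` in the variable `i = dir j`. -/
noncomputable def modulatedKernelMatrix (p : ℝ[X]) (z : ι → Fin d → ℂ) (M : ℕ) (a b : ι → ℂ)
    (dir : ι → Fin d) : Matrix ι ι ℂ :=
  of fun j k => (a j - b j * conj (z k (dir j)) ^ M) * torusKernel p (z j) (z k)

theorem modulatedKernelMatrix_mulVec_apply (p : ℝ[X]) (z : ι → Fin d → ℂ) (M : ℕ) (a b : ι → ℂ)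
    (dir : ι → Fin d) (v : ι → ℂ) (j : ι) :
    (modulatedKernelMatrix p z M a b dir *ᵥ v) j =
      a j * (kernelMatrix p z *ᵥ v) j -
        b j * (kernelMatrix p z *ᵥ
          fun k => conj (∏ i, z k i ^ (Pi.single (dir j) M : Fin d → ℕ) i) * v k) j := by
  simp only [modulatedKernelMatrix, kernelMatrix, mulVec, dotProduct, of_apply, Finset.mul_sum,
    ← Finset.sum_sub_distrib, Pi.single_apply, pow_ite, pow_zero, Finset.prod_ite_eq',
    Finset.mem_univ, if_true, map_pow]
  exact Finset.sum_congr rfl fun k _ => by ring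

variable [DecidableEq ι]

theorem norm_kernelMatrix_mulVec_sq_le (z : ι → Fin d → ℂ) {p : ℝ[X]} {C : ℝ}
    (hp0 : ∀ a, 0 ≤ p.coeff a) (hpC : ∀ a, p.coeff a ≤ C) {K N : ℕ} (hK : p.natDegree < K)
    {β : Fin d → ℕ} (hβ : ∀ i, K + β i ≤ N) (v : ι → ℂ) :
    ‖WithLp.toLp 2 (kernelMatrix p z *ᵥ fun j => conj (∏ i, z j i ^ β i) * v j)‖ ^ 2 ≤
      C ^ d * ‖kernelMatrix p z‖ * ‖WithLp.toLp 2 ((monomialMatrix z N)ᴴ *ᵥ v)‖ ^ 2 := by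
  let w (α : Fin d → Fin K) : ℝ := ∏ i, p.coeff (α i)
  have hw0 (α : Fin d → Fin K) : 0 ≤ w α := Finset.prod_nonneg fun i _ => hp0 _
  have hwC (α : Fin d → Fin K) : w α ≤ C ^ d := by
    simpa only [Finset.prod_const, Finset.card_univ, Fintype.card_fin] using
      Finset.prod_le_prod (fun i _ => hp0 (α i)) fun i (_ : i ∈ Finset.univ) => hpC (α i)
  have hfactor := monomialMatrix_mul_diagonal_mul_conjTranspose z hK
  have hweighted : ‖monomialMatrix z K * diagonal fun α => (w α : ℂ)‖ ^ 2 ≤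
      C ^ d * ‖kernelMatrix p z‖ := by
    rw [← hfactor]
    exact l2_opNorm_mul_diagonal_sq_le _ hw0 hwC (pow_nonneg ((hp0 0).trans (hpC 0)) d)
  let u : ι → ℂ := fun j => conj (∏ i, z j i ^ β i) * v j
  calc ‖WithLp.toLp 2 (kernelMatrix p z *ᵥ u)‖ ^ 2
      ≤ (‖monomialMatrix z K * diagonal fun α => (w α : ℂ)‖ *
          ‖WithLp.toLp 2 ((monomialMatrix z K)ᴴ *ᵥ u)‖) ^ 2 := by
        rw [← hfactor, ← mulVec_mulVec]
        gcongr
        exact l2_opNorm_mulVec _ (WithLp.toLp 2 _)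
    _ ≤ C ^ d * ‖kernelMatrix p z‖ * ‖WithLp.toLp 2 ((monomialMatrix z N)ᴴ *ᵥ v)‖ ^ 2 := by
        rw [mul_pow]
        gcongr
        · exact (sq_nonneg _).trans hweighted
        · exact norm_conjTranspose_mulVec_monomial_mul_le z hβ v

theorem norm_modulatedKernelMatrix_mulVec_sq_le (z : ι → Fin d → ℂ) {p : ℝ[X]} {C κ : ℝ}
    (hp0 : ∀ a, 0 ≤ p.coeff a) (hpC : ∀ a, p.coeff a ≤ C) {M N : ℕ} (hN : p.natDegree + M < N)
    {a b : ι → ℂ} (ha : ∀ j, ‖a j‖ ≤ κ) (hb : ∀ j, ‖b j‖ ≤ κ) (dir : ι → Fin d) (v : ι → ℂ) :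
    ‖WithLp.toLp 2 (modulatedKernelMatrix p z M a b dir *ᵥ v)‖ ^ 2 ≤
      2 * κ ^ 2 * (1 + d) * (C ^ d * ‖kernelMatrix p z‖) *
        ‖WithLp.toLp 2 ((monomialMatrix z N)ᴴ *ᵥ v)‖ ^ 2 := by
  let x (β : Fin d → ℕ) : ι → ℂ := kernelMatrix p z *ᵥ fun j => conj (∏ i, z j i ^ β i) * v j
  let B : ℝ := C ^ d * ‖kernelMatrix p z‖ * ‖WithLp.toLp 2 ((monomialMatrix z N)ᴴ *ᵥ v)‖ ^ 2
  have hx {β : Fin d → ℕ} (hβ : ∀ i, β i ≤ M) : ∑ j, ‖x β j‖ ^ 2 ≤ B := by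
    have := norm_kernelMatrix_mulVec_sq_le z hp0 hpC (Nat.lt_succ_self _) (N := N) (β := β)
      (fun i => by have := hβ i; omega) v
    rwa [EuclideanSpace.norm_sq_eq] at this
  have hW (j : ι) : (modulatedKernelMatrix p z M a b dir *ᵥ v) j =
      a j * x 0 j - b j * x (Pi.single (dir j) M) j := by
    simpa [x] using modulatedKernelMatrix_mulVec_apply p z M a b dir v j
  have hentry (j : ι) : ‖(modulatedKernelMatrix p z M a b dir *ᵥ v) j‖ ^ 2 ≤
      2 * κ ^ 2 * (‖x 0 j‖ ^ 2 + ∑ i, ‖x (Pi.single i M) j‖ ^ 2) := by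
    calc _ ≤ (κ * ‖x 0 j‖ + κ * ‖x (Pi.single (dir j) M) j‖) ^ 2 := by
          rw [hW]
          gcongr
          refine (norm_sub_le _ _).trans ?_
          rw [norm_mul, norm_mul]
          gcongr
          exacts [ha j, hb j]
      _ ≤ 2 * ((κ * ‖x 0 j‖) ^ 2 + (κ * ‖x (Pi.single (dir j) M) j‖) ^ 2) := add_sq_le
      _ = 2 * κ ^ 2 * (‖x 0 j‖ ^ 2 + ‖x (Pi.single (dir j) M) j‖ ^ 2) := by ring
      _ ≤ _ := by
          gcongr
          exact Finset.single_le_sum (f := fun i => ‖x (Pi.single i M) j‖ ^ 2)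
            (fun _ _ => by positivity) (Finset.mem_univ (dir j))
  calc ‖WithLp.toLp 2 (modulatedKernelMatrix p z M a b dir *ᵥ v)‖ ^ 2
      ≤ ∑ j, 2 * κ ^ 2 * (‖x 0 j‖ ^ 2 + ∑ i, ‖x (Pi.single i M) j‖ ^ 2) := by
        rw [EuclideanSpace.norm_sq_eq]
        exact Finset.sum_le_sum fun j _ => hentry j
    _ = 2 * κ ^ 2 * (∑ j, ‖x 0 j‖ ^ 2 + ∑ i, ∑ j, ‖x (Pi.single i M) j‖ ^ 2) := by
        rw [← Finset.mul_sum, Finset.sum_add_distrib, Finset.sum_comm]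
    _ ≤ 2 * κ ^ 2 * (B + ∑ _i : Fin d, B) := by
        gcongr with i
        · exact hx fun _ => Nat.zero_le M
        · exact hx fun l => by rw [Pi.single_apply]; split_ifs <;> omega
    _ = _ := by
        rw [Finset.sum_const, Finset.card_univ, Fintype.card_fin, nsmul_eq_mul]
        ring

end MonomialMatrix

section WrapDist

open scoped FourierTransform ComplexConjugate

variable {d : ℕ}

/-- The representative of `t - t'` modulo `ℤ^d` with coordinates in `[-1/2, 1/2]`; its norm is
`wrapDist t t'`. -/
noncomputable def wrapVec (t t' : Fin d → ℝ) : Fin d → ℝ :=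
  fun i => t i - t' i - round (t i - t' i)

theorem abs_wrapVec_le_half (t t' : Fin d → ℝ) (i : Fin d) : |wrapVec t t' i| ≤ 1 / 2 :=
  abs_sub_round _

theorem wrapDist_le_norm (t t' : Fin d → ℝ) (r : Fin d → ℤ) :
    wrapDist t t' ≤ ‖t - t' + fun i => (r i : ℝ)‖ :=
  ciInf_le ⟨0, by rintro _ ⟨r, rfl⟩; exact norm_nonneg _⟩ r

theorem wrapDist_eq_norm_wrapVec (t t' : Fin d → ℝ) : wrapDist t t' = ‖wrapVec t t'‖ := by
  apply le_antisymm
  · refine (wrapDist_le_norm t t' fun i => -round (t i - t' i)).trans_eq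
      (congrArg _ (funext fun i => ?_))
    simp [wrapVec, sub_eq_add_neg]
  · refine le_ciInf fun r => (pi_norm_le_iff_of_nonneg (norm_nonneg _)).2 fun i => ?_
    refine le_trans ?_ (norm_le_pi_norm _ i)
    simpa [wrapVec] using round_le (t i - t' i) (-r i)

theorem wrapDist_nonneg (t t' : Fin d → ℝ) : 0 ≤ wrapDist t t' :=
  wrapDist_eq_norm_wrapVec t t' ▸ norm_nonneg _

theorem wrapDist_self (t : Fin d → ℝ) : wrapDist t t = 0 := by
  rw [wrapDist_eq_norm_wrapVec, norm_eq_zero]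
  ext i
  simp [wrapVec]

theorem wrapDist_comm (t t' : Fin d → ℝ) : wrapDist t t' = wrapDist t' t := by
  refine (Equiv.neg (Fin d → ℤ)).iInf_congr fun r => ?_
  rw [← norm_neg]
  congr 1
  ext i
  simp
  ring

theorem wrapDist_le_half (t t' : Fin d → ℝ) : wrapDist t t' ≤ 1 / 2 := by
  rw [wrapDist_eq_norm_wrapVec]
  exact (pi_norm_le_iff_of_nonneg (by norm_num)).2 (abs_wrapVec_le_half t t')

theorem wrapDist_pos {t t' : Fin d → ℝ} (ht : ∀ i, t i ∈ Set.Ico (0 : ℝ) 1)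
    (ht' : ∀ i, t' i ∈ Set.Ico (0 : ℝ) 1) (hne : t ≠ t') : 0 < wrapDist t t' := by
  rw [wrapDist_eq_norm_wrapVec, norm_pos_iff]
  refine fun h => hne (funext fun i => ?_)
  have hround : t i - t' i = round (t i - t' i) := sub_eq_zero.1 (congrFun h i)
  have hlt : |(round (t i - t' i) : ℝ)| < 1 := by
    rw [← hround, abs_lt]
    constructor <;> linarith [(ht i).1, (ht i).2, (ht' i).1, (ht' i).2]
  rw [← Int.cast_abs, ← Int.cast_one, Int.cast_lt, Int.abs_lt_one_iff] at hlt
  rwa [hlt, Int.cast_zero, sub_eq_zero] at hround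

theorem wrapDist_lt_of_abs_wrapVec_sub_lt {t t' t'' : Fin d → ℝ} {s : ℝ} (hs : 0 < s)
    (h : ∀ i, |wrapVec t t' i - wrapVec t t'' i| < s) : wrapDist t' t'' < s := by
  rw [wrapDist_comm]
  refine (wrapDist_le_norm t'' t' fun i =>
    round (t i - t'' i) - round (t i - t' i)).trans_lt ((pi_norm_lt_iff hs).2 fun i => ?_)
  convert h i using 1
  rw [Real.norm_eq_abs]
  simp only [wrapVec, Pi.add_apply, Pi.sub_apply, Int.cast_sub]
  ring_nf

theorem exists_abs_wrapVec_eq_wrapDist (hd : 1 ≤ d) (t t' : Fin d → ℝ) :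
    ∃ i, |wrapVec t t' i| = wrapDist t t' := by
  have : Nonempty (Fin d) := ⟨⟨0, hd⟩⟩
  obtain ⟨i, hi⟩ := Finite.exists_max fun i => |wrapVec t t' i|
  refine ⟨i, ?_⟩
  rw [wrapDist_eq_norm_wrapVec]
  exact le_antisymm (norm_le_pi_norm (wrapVec t t') i)
    ((pi_norm_le_iff_of_nonneg (abs_nonneg _)).2 hi)

theorem node_apply (t : Fin d → ℝ) (i : Fin d) : node t i = 𝐞 (t i) := by
  rw [node, Real.fourierChar_apply]
  congr 1
  push_cast
  ring

theorem norm_node (t : Fin d → ℝ) (i : Fin d) : ‖node t i‖ = 1 := by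
  rw [node_apply, Circle.norm_coe]

theorem node_mul_conj_node (t t' : Fin d → ℝ) (i : Fin d) :
    node t i * conj (node t' i) = 𝐞 (wrapVec t t' i) := by
  rw [wrapVec, fourierChar_sub_intCast, node_apply, node_apply, AddChar.map_sub_eq_div,
    div_eq_mul_inv, Circle.coe_mul, Circle.coe_inv_eq_conj]

end WrapDist

section Modulation

open scoped FourierTransform ComplexConjugate

variable {d : ℕ}

theorem exists_four_mul_wrapDist_le_norm_node_pow_sub (hd : 1 ≤ d) {M : ℕ} {t t' : Fin d → ℝ}
    (hM : M * wrapDist t t' ≤ 1 / 2) :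
    ∃ i, 4 * (M * wrapDist t t') ≤ ‖node t i ^ M - node t' i ^ M‖ := by
  obtain ⟨i, hi⟩ := exists_abs_wrapVec_eq_wrapDist hd t t'
  have habs : |M * wrapVec t t' i| = M * wrapDist t t' := by rw [abs_mul, Nat.abs_cast, hi]
  refine ⟨i, ?_⟩
  calc 4 * (M * wrapDist t t') = 4 * |M * wrapVec t t' i| := by rw [habs]
    _ ≤ ‖(𝐞 (M * wrapVec t t' i) : ℂ) - 1‖ :=
        four_mul_abs_le_norm_fourierChar_sub_one (habs.trans_le hM)
    _ = ‖(node t i * conj (node t' i)) ^ M - 1‖ := by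
        rw [node_mul_conj_node, ← nsmul_eq_mul, AddChar.map_nsmul_eq_pow, Circle.coe_pow]
    _ = ‖((node t i * conj (node t' i)) ^ M - 1) * node t' i ^ M‖ := by
        rw [norm_mul, norm_pow (node t' i), norm_node, one_pow, mul_one]
    _ = ‖node t i ^ M - node t' i ^ M‖ := by
        rw [sub_mul, one_mul, ← mul_pow, mul_assoc, Complex.conj_mul', norm_node,
          Complex.ofReal_one, one_pow, mul_one]

theorem exists_modulation_eq_one_eq_zero (hd : 1 ≤ d) {M : ℕ} {t t' : Fin d → ℝ}
    (hM : M * wrapDist t t' ≤ 1 / 2) {δ : ℝ} (hδ : 0 < δ) (hδM : δ ≤ 4 * (M * wrapDist t t')) :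
    ∃ (a b : ℂ) (i : Fin d), ‖a‖ ≤ δ⁻¹ ∧ ‖b‖ ≤ δ⁻¹ ∧
      a - b * conj (node t i) ^ M = 1 ∧ a - b * conj (node t' i) ^ M = 0 := by
  obtain ⟨i, hi⟩ := exists_four_mul_wrapDist_le_norm_node_pow_sub hd hM
  set D : ℂ := conj (node t' i) ^ M - conj (node t i) ^ M with hD
  have hδD : δ ≤ ‖D‖ := by
    rw [hD, ← map_pow, ← map_pow, ← map_sub, RCLike.norm_conj, norm_sub_rev]
    exact hδM.trans hi
  have hb : ‖D⁻¹‖ ≤ δ⁻¹ := by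
    rw [norm_inv]
    gcongr
  refine ⟨D⁻¹ * conj (node t' i) ^ M, D⁻¹, i, ?_, hb, ?_, sub_self _⟩
  · rwa [norm_mul, norm_pow, RCLike.norm_conj, norm_node, one_pow, mul_one]
  · rw [← mul_sub]
    exact inv_mul_cancel₀ (norm_pos_iff.1 (hδ.trans_le hδD))

end Modulation

section Decay

open Polynomial
open scoped FourierTransform

variable {d : ℕ}

/-- A summable bound for the values of a localized kernel on the cells of a grid: `1` at `ν = 0` and
`B / ν ^ 2` otherwise. -/
noncomputable def invSqMajorant (B : ℝ) (ν : ℤ) : ℝ :=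
  if ν = 0 then 1 else B / (ν : ℝ) ^ 2

theorem invSqMajorant_zero (B : ℝ) : invSqMajorant B 0 = 1 := if_pos rfl

theorem invSqMajorant_nonneg {B : ℝ} (hB : 0 ≤ B) (ν : ℤ) : 0 ≤ invSqMajorant B ν := by
  rw [invSqMajorant]
  positivity

theorem sum_range_invSqMajorant_succ_le {B : ℝ} (hB : 0 ≤ B) (R : ℕ) :
    ∑ i ∈ Finset.range R, invSqMajorant B (i + 1 : ℕ) ≤ 2 * B := by
  calc ∑ i ∈ Finset.range R, invSqMajorant B (i + 1 : ℕ)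
      = B * ∑ i ∈ Finset.Ioo 0 (R + 1), ((i : ℝ) ^ 2)⁻¹ := by
        rw [← Finset.Ico_add_one_left_eq_Ioo, zero_add, Finset.sum_Ico_eq_sum_range,
          Finset.mul_sum]
        refine Finset.sum_congr rfl fun i _ => ?_
        rw [invSqMajorant, if_neg (by omega), div_eq_mul_inv, Int.cast_natCast, add_comm i]
    _ ≤ B * (2 / ((0 : ℕ) + 1)) := by
        gcongr
        exact sum_Ioo_inv_sq_le 0 (R + 1)
    _ = 2 * B := by
        push_cast
        ring

theorem sum_invSqMajorant_le {B : ℝ} (hB : 0 ≤ B) (T : Finset ℤ) :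
    ∑ ν ∈ T, invSqMajorant B ν ≤ 1 + 4 * B := by
  set R : ℕ := T.sup Int.natAbs
  have hT : T ⊆ Finset.Icc (-(R : ℤ)) R := fun ν hν => by
    have : ν.natAbs ≤ R := Finset.le_sup hν
    rw [Finset.mem_Icc]
    omega
  have heven : Function.Even (invSqMajorant B) := fun ν => by simp [invSqMajorant]
  calc ∑ ν ∈ T, invSqMajorant B ν ≤ ∑ ν ∈ Finset.Icc (-(R : ℤ)) R, invSqMajorant B ν :=
        Finset.sum_le_sum_of_subset_of_nonneg hT fun ν _ _ => invSqMajorant_nonneg hB ν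
    _ = 1 + 2 * ∑ i ∈ Finset.range R, invSqMajorant B (i + 1 : ℕ) := by
        rw [Finset.sum_Icc_of_even_eq_range heven, Finset.sum_range_succ', Nat.cast_zero,
          invSqMajorant_zero, nsmul_eq_mul]
        push_cast
        ring
    _ ≤ 1 + 4 * B := by linarith [sum_range_invSqMajorant_succ_le hB R]

theorem sum_prod_invSqMajorant_le {ι : Type*} {B : ℝ} (hB : 0 ≤ B) {S : Finset ι}
    {μ : ι → Fin d → ℤ} (hμ0 : ∀ k ∈ S, μ k ≠ 0) {q : ℕ}
    (hμq : ∀ ν : Fin d → ℤ, {k ∈ S | μ k = ν}.card ≤ q) :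
    ∑ k ∈ S, ∏ i, invSqMajorant B (μ k i) ≤ q * ((1 + 4 * B) ^ d - 1) := by
  let T (i : Fin d) : Finset ℤ := insert 0 (S.image fun k => μ k i)
  have hzero : 0 ∈ Fintype.piFinset T :=
    Fintype.mem_piFinset.2 fun i => Finset.mem_insert_self _ _
  have hprod (ν : Fin d → ℤ) : 0 ≤ ∏ i, invSqMajorant B (ν i) :=
    Finset.prod_nonneg fun i _ => invSqMajorant_nonneg hB _
  have hmaps (k) (hk : k ∈ S) : μ k ∈ (Fintype.piFinset T).erase 0 :=
    Finset.mem_erase.2 ⟨hμ0 k hk, Fintype.mem_piFinset.2 fun i =>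
      Finset.mem_insert_of_mem (Finset.mem_image_of_mem (fun k => μ k i) hk)⟩
  calc ∑ k ∈ S, ∏ i, invSqMajorant B (μ k i)
      = ∑ ν ∈ (Fintype.piFinset T).erase 0, ∑ k ∈ S with μ k = ν, ∏ i, invSqMajorant B (ν i) := by
        rw [← Finset.sum_fiberwise_of_maps_to hmaps]
        refine Finset.sum_congr rfl fun ν _ => Finset.sum_congr rfl fun k hk => ?_
        rw [(Finset.mem_filter.1 hk).2]
    _ ≤ ∑ ν ∈ (Fintype.piFinset T).erase 0, q * ∏ i, invSqMajorant B (ν i) := by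
        refine Finset.sum_le_sum fun ν _ => ?_
        rw [Finset.sum_const, nsmul_eq_mul]
        exact mul_le_mul_of_nonneg_right (Nat.cast_le.2 (hμq ν)) (hprod ν)
    _ = q * (∏ i, ∑ ν ∈ T i, invSqMajorant B ν - 1) := by
        rw [← Finset.mul_sum, Finset.sum_erase_eq_sub hzero, ← Finset.prod_univ_sum]
        simp only [Pi.zero_apply, invSqMajorant_zero, Finset.prod_const_one]
    _ ≤ q * ((1 + 4 * B) ^ d - 1) := by
        gcongr
        simpa only [Finset.prod_const, Finset.card_univ, Fintype.card_fin] using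
          Finset.prod_le_prod
            (fun i _ => Finset.sum_nonneg fun ν _ => invSqMajorant_nonneg hB ν)
            fun i (_ : i ∈ Finset.univ) => sum_invSqMajorant_le hB (T i)

theorem abs_sub_lt_of_round_div_eq {x y s : ℝ} (hs : 0 < s) (h : round (x / s) = round (y / s)) :
    |x - y| < s := by
  rw [round_eq, round_eq] at h
  have hlt := Int.abs_sub_lt_one_of_floor_eq_floor h
  rwa [add_sub_add_right_eq_sub, ← sub_div, abs_div, abs_of_pos hs, div_lt_one hs] at hlt

theorem abs_round_div_mul_le {x s : ℝ} (hs : 0 < s) : |(round (x / s) : ℝ)| * s ≤ 2 * |x| := by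
  rcases eq_or_ne (round (x / s)) 0 with h0 | h0
  · simp [h0]
  have hone : (1 : ℝ) ≤ |(round (x / s) : ℝ)| := by
    rw [← Int.cast_abs]
    exact_mod_cast Int.one_le_abs h0
  have hround : |x / s - round (x / s)| ≤ 1 / 2 := abs_sub_round _
  have htri := abs_sub_abs_le_abs_sub (round (x / s) : ℝ) (x / s)
  rw [abs_sub_comm, abs_div, abs_of_pos hs] at htri
  rw [← le_div_iff₀ hs, mul_div_assoc]
  linarith

theorem norm_aeval_localizer_le_invSqMajorant (hd : 1 ≤ d) {m m' : ℕ} (hm : 0 < m) (hm' : 0 < m')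
    {x s : ℝ} (hx : |x| ≤ 1 / 2) (hs : 0 < s) :
    ‖aeval (𝐞 x : ℂ) (localizer d m m')‖ ≤
      invSqMajorant (1 / ((m * s) * (m' * s) ^ d)) (round (x / s)) := by
  rw [invSqMajorant]
  split_ifs with h0
  · rw [← eval_one_localizer d hm hm']
    exact norm_aeval_le_eval_one (coeff_localizer_nonneg d m m') (Circle.norm_coe _).le
  set ν : ℝ := |(round (x / s) : ℝ)| with hν
  have hν1 : 1 ≤ ν := by
    rw [hν, ← Int.cast_abs]
    exact_mod_cast Int.one_le_abs h0
  have hνx : ν * s ≤ 2 * |x| := abs_round_div_mul_le hs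
  have hx0 : 0 < |x| := by nlinarith
  have hfactor {r : ℕ} (hr : 0 < r) : 1 / (2 * r * |x|) ≤ 1 / (r * s * ν) := by
    rw [show (2 * r * |x| : ℝ) = r * (2 * |x|) by ring, mul_assoc, mul_comm s]
    gcongr
  calc ‖aeval (𝐞 x : ℂ) (localizer d m m')‖
      ≤ 1 / (2 * m * |x|) * (1 / (2 * m' * |x|)) ^ d :=
        norm_aeval_localizer_le (abs_pos.1 hx0) hx d m m'
    _ ≤ 1 / (m * s * ν) * (1 / (m' * s * ν)) ^ d := by
        gcongr ?_ * ?_ ^ d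
        exacts [hfactor hm, hfactor hm']
    _ = 1 / ((m * s) * (m' * s) ^ d) / ν ^ (d + 1) := by
        rw [one_div_pow, mul_pow, pow_succ, one_div_mul_one_div, div_div]
        ring_nf
    _ ≤ 1 / ((m * s) * (m' * s) ^ d) / ν ^ 2 := by
        gcongr
        omega
    _ = 1 / ((m * s) * (m' * s) ^ d) / (round (x / s) : ℝ) ^ 2 := by rw [hν, sq_abs]

theorem sum_norm_torusKernel_localizer_le {ι γ : Type*} [Fintype ι] [DecidableEq γ] (hd : 1 ≤ d)
    {m m' : ℕ} (hm : 0 < m) (hm' : 0 < m') {t : ι → Fin d → ℝ} {cl : ι → γ} {q : ℕ} {s : ℝ}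
    (hs : 0 < s) (hcard : ∀ c, (Finset.univ.filter fun k => cl k = c).card ≤ q)
    (hsep : ∀ j k, cl j ≠ cl k → s ≤ wrapDist (t j) (t k)) (j : ι) :
    ∑ k with cl j ≠ cl k, ‖torusKernel (localizer d m m') (node (t j)) (node (t k))‖ ≤
      q * ((1 + 4 * (1 / ((m * s) * (m' * s) ^ d))) ^ d - 1) := by
  let μ (k : ι) (i : Fin d) : ℤ := round (wrapVec (t j) (t k) i / s)
  have hlabel {k k' : ι} (h : μ k = μ k') : cl k = cl k' := by
    by_contra hc
    exact (hsep k k' hc).not_gt <| wrapDist_lt_of_abs_wrapVec_sub_lt hs fun i =>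
      abs_sub_lt_of_round_div_eq hs (congrFun h i)
  have hμj : μ j = 0 := by
    ext i
    simp [μ, wrapVec]
  calc _ ≤ ∑ k with cl j ≠ cl k,
          ∏ i, invSqMajorant (1 / ((m * s) * (m' * s) ^ d)) (μ k i) := by
        refine Finset.sum_le_sum fun k _ => ?_
        rw [torusKernel, norm_prod]
        gcongr with i
        rw [node_mul_conj_node]
        exact norm_aeval_localizer_le_invSqMajorant hd hm hm' (abs_wrapVec_le_half _ _ i) hs
    _ ≤ _ := by
        refine sum_prod_invSqMajorant_le (by positivity) (fun k hk h => ?_) fun ν => ?_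
        · exact (Finset.mem_filter.1 hk).2 (hlabel (hμj.trans h.symm))
        · rcases (Finset.filter (fun k => μ k = ν)
            {k | cl j ≠ cl k}).eq_empty_or_nonempty with he | ⟨k₀, hk₀⟩
          · simp [he]
          · refine (Finset.card_le_card fun k hk => ?_).trans (hcard (cl k₀))
            exact Finset.mem_filter.2 ⟨Finset.mem_univ k, hlabel
              ((Finset.mem_filter.1 hk).2.trans (Finset.mem_filter.1 hk₀).2.symm)⟩

end Decay

section NearIdentity

open Matrix Polynomial
open scoped Matrix.Norms.L2Operator ComplexConjugate

variable {d : ℕ} {ι γ : Type*} [Fintype ι] [DecidableEq γ]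
  {p : ℝ[X]} {z : ι → Fin d → ℂ} {cl : ι → γ}

theorem norm_kernelMatrix_le [DecidableEq ι] (hp0 : ∀ a, 0 ≤ p.coeff a) (hp1 : p.eval 1 = 1)
    (hz : ∀ j i, ‖z j i‖ = 1) {q : ℕ} {ε : ℝ} (hε : 0 ≤ ε)
    (hcard : ∀ c, (Finset.univ.filter fun k => cl k = c).card ≤ q)
    (hfar : ∀ j, ∑ k with cl j ≠ cl k, ‖torusKernel p (z j) (z k)‖ ≤ ε) :
    ‖kernelMatrix p z‖ ≤ q + ε := by
  refine l2_opNorm_le_of_norm_le_symm (h := fun j k => ‖torusKernel p (z j) (z k)‖)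
    (by positivity) (fun _ _ => le_rfl) (fun _ _ => norm_torusKernel_comm p _ _) fun j => ?_
  have hnear : ∑ k with cl j = cl k, ‖torusKernel p (z j) (z k)‖ ≤ q := by
    refine (Finset.sum_le_card_nsmul _ _ 1 fun k _ =>
      norm_torusKernel_le_one hp0 hp1 (hz j) (hz k)).trans ?_
    simp only [eq_comm (a := cl j), nsmul_eq_mul, mul_one, Nat.cast_le, hcard]
  rw [← Finset.sum_filter_add_sum_filter_not Finset.univ fun k => cl j = cl k]
  exact add_le_add hnear (hfar j)

theorem norm_modulatedKernelMatrix_sub_one_le [DecidableEq ι] (hp1 : p.eval 1 = 1)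
    (hz : ∀ j i, ‖z j i‖ = 1)
    {M : ℕ} {a b : ι → ℂ} {dir : ι → Fin d} {κ ε : ℝ} (hκ : 0 ≤ κ) (hε : 0 ≤ ε)
    (ha : ∀ j, ‖a j‖ ≤ κ) (hb : ∀ j, ‖b j‖ ≤ κ)
    (hself : ∀ j, a j - b j * conj (z j (dir j)) ^ M = 1)
    (hother : ∀ j k, k ≠ j → cl k = cl j → a j - b j * conj (z k (dir j)) ^ M = 0)
    (hfar : ∀ j, ∑ k with cl j ≠ cl k, ‖torusKernel p (z j) (z k)‖ ≤ ε) :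
    ‖modulatedKernelMatrix p z M a b dir - 1‖ ≤ 2 * κ * ε := by
  refine l2_opNorm_le_of_norm_le_symm
    (h := fun j k => if cl j ≠ cl k then 2 * κ * ‖torusKernel p (z j) (z k)‖ else 0)
    (by positivity) (fun j k => ?_) (fun j k => ?_) fun j => ?_
  · rw [Matrix.sub_apply, modulatedKernelMatrix, of_apply]
    split_ifs with hjk
    · rw [one_apply_ne (ne_of_apply_ne cl hjk), sub_zero, norm_mul]
      gcongr
      calc ‖a j - b j * conj (z k (dir j)) ^ M‖ ≤ ‖a j‖ + ‖b j * conj (z k (dir j)) ^ M‖ :=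
            norm_sub_le _ _
        _ = ‖a j‖ + ‖b j‖ := by rw [norm_mul, norm_pow, RCLike.norm_conj, hz, one_pow, mul_one]
        _ ≤ 2 * κ := by linarith [ha j, hb j]
    · rcases eq_or_ne k j with rfl | hne
      · simp [hself, torusKernel_self hp1 (hz k)]
      · simp [hother j k hne (not_not.1 hjk).symm, one_apply_ne hne.symm]
  · simp only [norm_torusKernel_comm p (z j), ne_comm (a := cl j)]
  · rw [← Finset.sum_filter, ← Finset.mul_sum]
    exact mul_le_mul_of_nonneg_left (hfar j) (by positivity)

theorem norm_sq_le_of_modulation (hp0 : ∀ a, 0 ≤ p.coeff a) (hp1 : p.eval 1 = 1) {C : ℝ}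
    (hpC : ∀ a, p.coeff a ≤ C) {M N : ℕ} (hN : p.natDegree + M < N) (hz : ∀ j i, ‖z j i‖ = 1)
    {q : ℕ} (hcard : ∀ c, (Finset.univ.filter fun k => cl k = c).card ≤ q) {κ ε : ℝ} (hκ : 0 ≤ κ)
    (hε : 0 ≤ ε) (hκε : 2 * κ * ε ≤ 1 / 2)
    (hmod : ∀ j, ∃ (a b : ℂ) (i : Fin d), ‖a‖ ≤ κ ∧ ‖b‖ ≤ κ ∧ a - b * conj (z j i) ^ M = 1 ∧
      ∀ k, k ≠ j → cl k = cl j → a - b * conj (z k i) ^ M = 0)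
    (hfar : ∀ j, ∑ k with cl j ≠ cl k, ‖torusKernel p (z j) (z k)‖ ≤ ε)
    (v : EuclideanSpace ℂ ι) :
    ‖v‖ ^ 2 ≤ 8 * κ ^ 2 * (1 + d) * (C ^ d * (q + ε)) *
      ‖WithLp.toLp 2 ((monomialMatrix z N)ᴴ *ᵥ v)‖ ^ 2 := by
  classical
  choose a b dir ha hb hself hother using hmod
  have hC : 0 ≤ C := (hp0 0).trans (hpC 0)
  set W := modulatedKernelMatrix p z M a b dir
  have hW1 : ‖W - 1‖ ≤ 1 / 2 :=
    (norm_modulatedKernelMatrix_sub_one_le hp1 hz hκ hε ha hb hself hother hfar).trans hκε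
  calc ‖v‖ ^ 2 ≤ (2 * ‖WithLp.toLp 2 (W *ᵥ v)‖) ^ 2 := by
        gcongr
        exact norm_le_two_mul_norm_mulVec hW1 v
    _ = 4 * ‖WithLp.toLp 2 (W *ᵥ v)‖ ^ 2 := by ring
    _ ≤ 4 * (2 * κ ^ 2 * (1 + d) * (C ^ d * (q + ε)) *
          ‖WithLp.toLp 2 ((monomialMatrix z N)ᴴ *ᵥ v)‖ ^ 2) := by
        gcongr
        refine (norm_modulatedKernelMatrix_mulVec_sq_le z hp0 hpC hN ha hb dir v).trans ?_
        gcongr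
        exact norm_kernelMatrix_le hp0 hp1 hz hε hcard hfar
    _ = _ := by ring

end NearIdentity

section Separation

variable {d N : ℕ} {Ω : Finset (Fin d → ℝ)}

theorem finite_setOf_wrapDist (Ω : Finset (Fin d → ℝ)) :
    {x : ℝ | ∃ t ∈ Ω, ∃ t' ∈ Ω, t ≠ t' ∧ x = wrapDist t t'}.Finite := by
  refine ((Ω ×ˢ Ω).finite_toSet.image fun p => wrapDist p.1 p.2).subset ?_
  rintro x ⟨t, ht, t', ht', -, rfl⟩
  exact ⟨(t, t'), Finset.mem_product.2 ⟨ht, ht'⟩, rfl⟩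

theorem minSep_le (N : ℕ) {t t' : Fin d → ℝ} (ht : t ∈ Ω) (ht' : t' ∈ Ω) (hne : t ≠ t') :
    minSep N Ω ≤ N * wrapDist t t' :=
  mul_le_mul_of_nonneg_left
    (csInf_le (finite_setOf_wrapDist Ω).bddBelow ⟨t, ht, t', ht', hne, rfl⟩) N.cast_nonneg

theorem exists_minSep_eq (N : ℕ) (hΩ : Ω.Nontrivial) :
    ∃ t ∈ Ω, ∃ t' ∈ Ω, t ≠ t' ∧ minSep N Ω = N * wrapDist t t' := by
  obtain ⟨t, ht, t', ht', hne⟩ := hΩ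
  have hdist : {x : ℝ | ∃ t ∈ Ω, ∃ t' ∈ Ω, t ≠ t' ∧ x = wrapDist t t'}.Nonempty :=
    ⟨_, t, ht, t', ht', hne, rfl⟩
  obtain ⟨s, hs, s', hs', hss, he⟩ := hdist.csInf_mem (finite_setOf_wrapDist Ω)
  exact ⟨s, hs, s', hs', hss, by rw [minSep, he]⟩

open Classical in
/-- The factor of a single node in the cluster complexity, which is the maximum of these factors
over all nodes. -/
noncomputable def nodeComplexity (N : ℕ) (Ω : Finset (Fin d → ℝ)) (t : Fin d → ℝ) : ℝ :=
  ∏ t' ∈ Ω with 0 < wrapDist t t' ∧ wrapDist t t' ≤ 1 / (N : ℝ), 1 / ((N : ℝ) * wrapDist t t')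

theorem nodeComplexity_le_clusterComplexity (N : ℕ) {t : Fin d → ℝ} (ht : t ∈ Ω) :
    nodeComplexity N Ω t ≤ clusterComplexity N Ω :=
  le_ciSup (f := fun t : Ω => nodeComplexity N Ω t) (Set.finite_range _).bddAbove ⟨t, ht⟩

theorem one_le_one_div_mul_wrapDist {t t' : Fin d → ℝ} (hpos : 0 < wrapDist t t')
    (hle : wrapDist t t' ≤ 1 / N) : 1 ≤ 1 / (N * wrapDist t t') := by
  have hN : (0 : ℝ) < N := one_div_pos.1 (hpos.trans_le hle)
  rwa [le_div_iff₀ (mul_pos hN hpos), one_mul, ← le_div_iff₀' hN]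

theorem one_le_nodeComplexity (N : ℕ) (Ω : Finset (Fin d → ℝ)) (t : Fin d → ℝ) :
    1 ≤ nodeComplexity N Ω t :=
  Finset.one_le_prod fun _ ht' =>
    one_le_one_div_mul_wrapDist (Finset.mem_filter.1 ht').2.1 (Finset.mem_filter.1 ht').2.2

theorem one_div_le_nodeComplexity {t t' : Fin d → ℝ} (ht' : t' ∈ Ω) (hpos : 0 < wrapDist t t')
    (hle : wrapDist t t' ≤ 1 / N) : 1 / (N * wrapDist t t') ≤ nodeComplexity N Ω t := by
  rw [← Finset.prod_singleton (fun t' => 1 / (N * wrapDist t t')) t']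
  refine Finset.prod_le_prod_of_subset_of_one_le
    (Finset.singleton_subset_iff.2 (Finset.mem_filter.2 ⟨ht', hpos, hle⟩))
    (fun s _ => by have := wrapDist_nonneg t s; positivity) fun s hs _ => ?_
  exact one_le_one_div_mul_wrapDist (Finset.mem_filter.1 hs).2.1 (Finset.mem_filter.1 hs).2.2

theorem one_le_clusterComplexity (N : ℕ) (hΩ : Ω.Nonempty) : 1 ≤ clusterComplexity N Ω :=
  let ⟨t, ht⟩ := hΩ
  (one_le_nodeComplexity N Ω t).trans (nodeComplexity_le_clusterComplexity N ht)

end Separation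

section Clusters

variable {d N L : ℕ} {Ω : Finset (Fin d → ℝ)} {Λ : Fin L → Finset (Fin d → ℝ)}

theorem clusterSep_le {l l' : Fin L} (hl : l ≠ l') {t t' : Fin d → ℝ} (ht : t ∈ Λ l)
    (ht' : t' ∈ Λ l') : clusterSep N Λ ≤ ((N * wrapDist t t' : ℝ) : EReal) := by
  wlog h : l < l' generalizing l l' t t'
  · rw [wrapDist_comm]
    exact this hl.symm ht' ht (lt_of_le_of_ne (not_lt.1 h) hl.symm)
  rw [clusterSep, EReal.coe_mul, EReal.coe_natCast]
  refine mul_le_mul_of_nonneg_left ?_ (by positivity)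
  calc (⨅ (l : Fin L) (l' : Fin L) (_ : l < l'), clusterDist (Λ l) (Λ l'))
      ≤ clusterDist (Λ l) (Λ l') := iInf_le_of_le l (iInf₂_le l' h)
    _ ≤ wrapDist t t' := (iInf₂_le t ht).trans (iInf₂_le t' ht')

theorem IsCluster.wrapDist_le {S : Finset (Fin d → ℝ)} (hS : IsCluster N S)
    {t t' : Fin d → ℝ} (ht : t ∈ S) (ht' : t' ∈ S) : wrapDist t t' ≤ 1 / N := by
  obtain ⟨a, ha⟩ := hS
  obtain ⟨r, hr⟩ := ha t ht
  obtain ⟨r', hr'⟩ := ha t' ht'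
  refine (wrapDist_le_norm t t' fun i => r i - r' i).trans
    ((pi_norm_le_iff_of_nonneg (by positivity)).2 fun i => ?_)
  rw [Pi.add_apply, Pi.sub_apply, Real.norm_eq_abs, abs_le]
  push_cast
  constructor <;> linarith [(hr i).1, (hr i).2, (hr' i).1, (hr' i).2]

namespace IsClusteredConfiguration

theorem pos (h : IsClusteredConfiguration N Ω Λ) : 0 < N := by
  refine Nat.pos_of_ne_zero fun hN => ?_
  have hsep := h.one_lt_sep
  rw [clusterSep, hN, Nat.cast_zero, zero_mul] at hsep
  exact absurd hsep (by norm_num)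

theorem mem_iff (h : IsClusteredConfiguration N Ω Λ) {t : Fin d → ℝ} :
    t ∈ Ω ↔ ∃ l, t ∈ Λ l := by
  rw [← Finset.mem_coe, h.eq_iUnion, Set.mem_iUnion]
  rfl

/-- The index of the cluster containing a node; there is only one, since `1 < ρ`. -/
noncomputable def clusterIndex (h : IsClusteredConfiguration N Ω Λ) (t : Ω) : Fin L :=
  (h.mem_iff.1 t.2).choose

theorem mem_clusterIndex (h : IsClusteredConfiguration N Ω Λ) (t : Ω) :
    (t : Fin d → ℝ) ∈ Λ (h.clusterIndex t) :=
  (h.mem_iff.1 t.2).choose_spec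

theorem wrapDist_le_of_clusterIndex_eq (h : IsClusteredConfiguration N Ω Λ) {t t' : Ω}
    (ht : h.clusterIndex t = h.clusterIndex t') : wrapDist (t : Fin d → ℝ) t' ≤ 1 / N :=
  (h.isCluster _).wrapDist_le (h.mem_clusterIndex t) (ht ▸ h.mem_clusterIndex t')

theorem clusterSep_le_of_clusterIndex_ne (h : IsClusteredConfiguration N Ω Λ) {t t' : Ω}
    (ht : h.clusterIndex t ≠ h.clusterIndex t') :
    clusterSep N Λ ≤ ((N * wrapDist (t : Fin d → ℝ) t' : ℝ) : EReal) :=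
  clusterSep_le ht (h.mem_clusterIndex t) (h.mem_clusterIndex t')

theorem clusterIndex_eq_of_wrapDist_le (h : IsClusteredConfiguration N Ω Λ) {t t' : Ω}
    (ht : wrapDist (t : Fin d → ℝ) t' ≤ 1 / N) : h.clusterIndex t = h.clusterIndex t' := by
  by_contra hne
  have hsep := h.one_lt_sep.trans_le (h.clusterSep_le_of_clusterIndex_ne hne)
  have hfar : 1 < N * wrapDist (t : Fin d → ℝ) t' := by exact_mod_cast hsep
  rw [le_div_iff₀' (Nat.cast_pos.2 h.pos)] at ht
  exact hfar.not_ge ht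

theorem card_filter_clusterIndex_le (h : IsClusteredConfiguration N Ω Λ) (l : Fin L) :
    (Finset.univ.filter fun t => h.clusterIndex t = l).card ≤ maxClusterCard Λ := by
  refine (Finset.card_le_card_of_injOn Subtype.val (fun t ht => ?_)
    Subtype.val_injective.injOn).trans
      (Finset.le_sup (f := fun l => (Λ l).card) (Finset.mem_univ l))
  rw [← (Finset.mem_filter.1 ht).2]
  exact h.mem_clusterIndex t

theorem eq_of_clusterIndex_eq (h : IsClusteredConfiguration N Ω Λ) (hpair : maxClusterCard Λ ≤ 2)
    {t t' t'' : Ω} (ht' : h.clusterIndex t' = h.clusterIndex t)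
    (ht'' : h.clusterIndex t'' = h.clusterIndex t) (hne' : t' ≠ t) (hne'' : t'' ≠ t) :
    t' = t'' := by
  by_contra hne
  refine ((h.card_filter_clusterIndex_le (h.clusterIndex t)).trans hpair).not_gt
    (Finset.two_lt_card.2 ⟨t, ?_, t', ?_, t'', ?_, hne'.symm, hne''.symm, hne⟩) <;>
    simp [ht', ht'']

theorem exists_pair (h : IsClusteredConfiguration N Ω Λ) (hpair : maxClusterCard Λ = 2) :
    ∃ t ∈ Ω, ∃ t' ∈ Ω, t ≠ t' ∧ wrapDist t t' ≤ 1 / N := by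
  obtain ⟨l, -, hl⟩ : ∃ l ∈ Finset.univ, 1 < (Λ l).card :=
    Finset.lt_sup_iff.1 (hpair ▸ one_lt_two : 1 < maxClusterCard Λ)
  obtain ⟨t, ht, t', ht', hne⟩ := Finset.one_lt_card.1 hl
  exact ⟨t, h.mem_iff.2 ⟨l, ht⟩, t', h.mem_iff.2 ⟨l, ht'⟩, hne, (h.isCluster l).wrapDist_le ht ht'⟩

theorem eq_of_wrapDist_le (h : IsClusteredConfiguration N Ω Λ) (hpair : maxClusterCard Λ ≤ 2)
    {t t' t'' : Ω} (hpos' : 0 < wrapDist (t : Fin d → ℝ) t')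
    (hle' : wrapDist (t : Fin d → ℝ) t' ≤ 1 / N) (hpos'' : 0 < wrapDist (t : Fin d → ℝ) t'')
    (hle'' : wrapDist (t : Fin d → ℝ) t'' ≤ 1 / N) : t' = t'' := by
  refine h.eq_of_clusterIndex_eq hpair (h.clusterIndex_eq_of_wrapDist_le hle').symm
    (h.clusterIndex_eq_of_wrapDist_le hle'').symm ?_ ?_
  · rintro rfl
    exact hpos'.ne' (wrapDist_self _)
  · rintro rfl
    exact hpos''.ne' (wrapDist_self _)

theorem nodeComplexity_le_one_div_minSep (h : IsClusteredConfiguration N Ω Λ)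
    (hpair : maxClusterCard Λ ≤ 2) (hpos : 0 < minSep N Ω) (hle : minSep N Ω ≤ 1) (t : Ω) :
    nodeComplexity N Ω t ≤ 1 / minSep N Ω := by
  classical
  rw [nodeComplexity]
  rcases Finset.eq_empty_or_nonempty {t' ∈ Ω | 0 < wrapDist (t : Fin d → ℝ) t' ∧
    wrapDist (t : Fin d → ℝ) t' ≤ 1 / (N : ℝ)} with hempty | ⟨s, hs⟩
  · rw [hempty, Finset.prod_empty]
    exact one_le_one_div hpos hle
  · obtain ⟨hsΩ, hs0, hs1⟩ := Finset.mem_filter.1 hs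
    have hsingle : {t' ∈ Ω | 0 < wrapDist (t : Fin d → ℝ) t' ∧
        wrapDist (t : Fin d → ℝ) t' ≤ 1 / (N : ℝ)} = {s} := by
      refine Finset.eq_singleton_iff_unique_mem.2 ⟨hs, fun s' hs' => ?_⟩
      obtain ⟨hsΩ', hs0', hs1'⟩ := Finset.mem_filter.1 hs'
      exact congrArg Subtype.val <|
        h.eq_of_wrapDist_le hpair (t' := ⟨s', hsΩ'⟩) (t'' := ⟨s, hsΩ⟩) hs0' hs1' hs0 hs1
    rw [hsingle, Finset.prod_singleton]
    refine one_div_le_one_div_of_le hpos (minSep_le N t.2 hsΩ ?_)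
    rintro rfl
    exact hs0.ne' (wrapDist_self _)

theorem clusterComplexity_eq (h : IsClusteredConfiguration N Ω Λ) (hpair : maxClusterCard Λ = 2) :
    clusterComplexity N Ω = 1 / minSep N Ω := by
  obtain ⟨s, hs, s', hs', hss, hle⟩ := h.exists_pair hpair
  obtain ⟨t, ht, t', ht', htt, heq⟩ := exists_minSep_eq N ⟨s, hs, s', hs', hss⟩
  have hN : (0 : ℝ) < N := Nat.cast_pos.2 h.pos
  have hpos : 0 < wrapDist t t' := wrapDist_pos (h.mem_Ico t ht) (h.mem_Ico t' ht') htt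
  have hτ1 : minSep N Ω ≤ 1 :=
    (minSep_le N hs hs' hss).trans ((le_div_iff₀' hN).1 hle)
  have : Nonempty Ω := ⟨⟨t, ht⟩⟩
  apply le_antisymm
  · exact ciSup_le <|
      h.nodeComplexity_le_one_div_minSep hpair.le (heq ▸ mul_pos hN hpos) hτ1
  · rw [heq] at hτ1 ⊢
    exact (one_div_le_nodeComplexity ht' hpos ((le_div_iff₀' hN).2 hτ1)).trans
      (nodeComplexity_le_clusterComplexity N ht)

open scoped ComplexConjugate in
theorem exists_modulation (h : IsClusteredConfiguration N Ω Λ) (hd : 1 ≤ d)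
    (hpair : maxClusterCard Λ ≤ 2) {M : ℕ} (hM5 : N ≤ 5 * M) (hM2 : 2 * M ≤ N) (t : Ω) :
    ∃ (a b : ℂ) (i : Fin d), ‖a‖ ≤ 5 / 4 * clusterComplexity N Ω ∧
      ‖b‖ ≤ 5 / 4 * clusterComplexity N Ω ∧ a - b * conj (node (t : Fin d → ℝ) i) ^ M = 1 ∧
      ∀ t' : Ω, t' ≠ t → h.clusterIndex t' = h.clusterIndex t →
        a - b * conj (node (t' : Fin d → ℝ) i) ^ M = 0 := by
  have h𝒞 : 1 ≤ clusterComplexity N Ω := one_le_clusterComplexity N ⟨t, t.2⟩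
  by_cases hpartner : ∃ p : Ω, p ≠ t ∧ h.clusterIndex p = h.clusterIndex t
  · obtain ⟨p, hpt, hp⟩ := hpartner
    have hle := h.wrapDist_le_of_clusterIndex_eq hp.symm
    have hpos : 0 < wrapDist (t : Fin d → ℝ) p :=
      wrapDist_pos (h.mem_Ico t t.2) (h.mem_Ico p p.2) (Subtype.coe_ne_coe.2 hpt.symm)
    have hN : (0 : ℝ) < N := Nat.cast_pos.2 h.pos
    have hMN : (2 * M : ℝ) ≤ N := by exact_mod_cast hM2
    have hNM : (N : ℝ) ≤ 5 * M := by exact_mod_cast hM5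
    have hinv : 1 / (N * wrapDist (t : Fin d → ℝ) p) ≤ clusterComplexity N Ω :=
      (one_div_le_nodeComplexity p.2 hpos hle).trans (nodeComplexity_le_clusterComplexity N t.2)
    obtain ⟨a, b, i, ha, hb, hone, hzero⟩ :=
      exists_modulation_eq_one_eq_zero hd (M := M) (t := t) (t' := p)
        (δ := (5 / 4 * clusterComplexity N Ω)⁻¹) (by
          rw [le_div_iff₀' hN] at hle
          nlinarith) (by positivity) (by
          rw [div_le_iff₀ (by positivity)] at hinv
          rw [inv_le_iff_one_le_mul₀ (by positivity)]
          nlinarith [mul_pos hpos (zero_lt_one.trans_le h𝒞)])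
    rw [inv_inv] at ha hb
    refine ⟨a, b, i, ha, hb, hone, fun t' ht' hidx => ?_⟩
    rwa [h.eq_of_clusterIndex_eq hpair hidx hp ht' hpt]
  · refine ⟨1, 0, ⟨0, hd⟩, ?_, ?_, by ring, fun t' ht' hidx => absurd ⟨t', ht', hidx⟩ hpartner⟩
    · rw [norm_one]
      linarith
    · rw [norm_zero]
      positivity

end IsClusteredConfiguration

end Clusters

section Constants

variable {d N : ℕ}

theorem one_add_pow_sub_one_le {y : ℝ} (hy : 0 ≤ y) (hdy : d * y ≤ 1) :
    (1 + y) ^ d - 1 ≤ d * y + (d * y) ^ 2 := by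
  have hexp : (1 + y) ^ d ≤ Real.exp (d * y) := by
    rw [Real.exp_nat_mul, add_comm]
    gcongr
    exact Real.add_one_le_exp y
  have hquad := Real.abs_exp_sub_one_sub_id_le (x := d * y) (abs_le.2 ⟨by nlinarith, hdy⟩)
  linarith [(abs_le.1 hquad).2]

theorem two_mul_one_add_pow_sub_one_le {B c : ℝ} (hd : 1 ≤ d) (hc : 1 ≤ c) (hB0 : 0 ≤ B)
    (hB : B ≤ 1 / (72 * d * c)) : 2 * ((1 + 4 * B) ^ d - 1) ≤ 1 / (5 * c) := by
  have : (0 : ℝ) < d := Nat.cast_pos.2 hd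
  have hdB : d * (4 * B) ≤ 1 / 18 * (1 / c) := by
    calc d * (4 * B) ≤ d * (4 * (1 / (72 * d * c))) := by gcongr
      _ = 1 / 18 * (1 / c) := by
        field_simp
        norm_num
  have hc1 : 1 / c ≤ 1 := (div_le_one (by positivity)).2 hc
  have hpow := one_add_pow_sub_one_le (d := d) (by positivity : 0 ≤ 4 * B) (by linarith)
  have hdB0 : 0 ≤ d * (4 * B) := by positivity
  rw [show 1 / (5 * c) = 1 / 5 * (1 / c) by ring]
  nlinarith

-- `m ≈ N / 2` and `M ≈ N / 5` leave the degree `3 N / 10` to the `d` short factors of the kernel;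
-- for `24 ≤ N`, at least `N / 4` of it survives the roundings.
theorem exists_localizer_parameters (hd : 1 ≤ d) (hN : 2 ≤ N) :
    ∃ m m' M : ℕ, N ≤ 2 * m ∧ 0 < m' ∧ (24 ≤ N → N ≤ 4 * (d * m')) ∧ N ≤ 5 * M ∧ 2 * M ≤ N ∧
      (m - 1) + d * (m' - 1) + M < N := by
  obtain ⟨r, hr⟩ : ∃ r, r = N - (N + 4) / 5 - (N + 1) / 2 := ⟨_, rfl⟩
  have hle : d * (r / d) ≤ r := Nat.mul_div_le r d
  have hlt : r < d * (r / d + 1) := Nat.lt_mul_div_succ r hd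
  refine ⟨(N + 1) / 2, r / d + 1, (N + 4) / 5, by omega, Nat.succ_pos _, by omega, by omega,
    by omega, ?_⟩
  rw [Nat.add_sub_cancel]
  omega

theorem one_div_localizer_decay_le {m m' : ℕ} {s c Q : ℝ} (hd : 1 ≤ d) (hm : N ≤ 2 * m)
    (hm' : N ≤ 4 * (d * m')) (hQ : 0 < Q) (hQc : Q ^ (d + 1) = 4 * c) (hs : 12 * d * Q = N * s)
    (hs0 : 0 < s) : 1 / ((m * s) * (m' * s) ^ d) ≤ 1 / (72 * d * c) := by
  have hd0 : (0 : ℝ) < d := Nat.cast_pos.2 hd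
  have hm_s : 6 * d * Q ≤ m * s := by
    have : (N : ℝ) ≤ 2 * m := by exact_mod_cast hm
    nlinarith
  have hm's : 3 * Q ≤ m' * s := by
    have : (N : ℝ) ≤ 4 * (d * m') := by exact_mod_cast hm'
    refine le_of_mul_le_mul_left ?_ hd0
    nlinarith
  have hc : 0 < c := by linarith [pow_pos hQ (d + 1)]
  refine one_div_le_one_div_of_le (by positivity) ?_
  calc 72 * d * c = (6 * d * Q) * (3 * Q ^ d) := by linear_combination -18 * d * hQc
    _ ≤ (6 * d * Q) * (3 * Q) ^ d := by
        rw [mul_pow]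
        gcongr
        exact le_self_pow₀ (by norm_num) (by omega)
    _ ≤ (m * s) * (m' * s) ^ d := by gcongr

theorem natCast_le_rpow_half (hd : 1 ≤ d) : (d : ℝ) ≤ (d : ℝ) ^ ((d : ℝ) / 2) := by
  rcases hd.eq_or_lt with rfl | hd2
  · simp
  · refine Real.self_le_rpow_of_one_le (Nat.one_le_cast.2 hd) ?_
    have : (2 : ℝ) ≤ d := by exact_mod_cast hd2
    linarith

theorem sq_mul_rpow_half_div_eq (d N : ℕ) (τ : ℝ) :
    (τ * (N : ℝ) ^ ((d : ℝ) / 2) /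
      (12 * (2 : ℝ) ^ ((d : ℝ) / 2 - 1 / 2) * (d : ℝ) ^ ((d : ℝ) / 4))) ^ 2 =
      τ ^ 2 * (N : ℝ) ^ d / (72 * 2 ^ d * (d : ℝ) ^ ((d : ℝ) / 2)) := by
  have hsq {x : ℝ} (hx : 0 ≤ x) (y : ℝ) : (x ^ y) ^ 2 = x ^ (y * 2) := by
    rw [Real.rpow_mul hx, Real.rpow_two]
  rw [div_pow, mul_pow, mul_pow, mul_pow, hsq N.cast_nonneg, hsq zero_le_two, hsq d.cast_nonneg,
    show (d : ℝ) / 2 * 2 = d by ring, show ((d : ℝ) / 2 - 1 / 2) * 2 = d - 1 by ring,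
    show (d : ℝ) / 4 * 2 = d / 2 by ring, Real.rpow_sub_one two_ne_zero, Real.rpow_natCast,
    Real.rpow_natCast]
  ring

end Constants

namespace IsClusteredConfiguration

open Matrix

variable {d N L : ℕ} {Ω : Finset (Fin d → ℝ)} {Λ : Fin L → Finset (Fin d → ℝ)}

theorem sum_norm_torusKernel_le_one_div (h : IsClusteredConfiguration N Ω Λ) (hd : 1 ≤ d)
    (hpair : maxClusterCard Λ ≤ 2)
    (hρ : ((12 * d * (4 * clusterComplexity N Ω) ^ (1 / ((d : ℝ) + 1)) : ℝ) : EReal) ≤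
      clusterSep N Λ)
    {m m' : ℕ} (hm : N ≤ 2 * m) (hm' : 0 < m') (hm'N : 24 ≤ N → N ≤ 4 * (d * m')) (j : Ω) :
    ∑ k with h.clusterIndex j ≠ h.clusterIndex k,
        ‖torusKernel (localizer d m m') (node (j : Fin d → ℝ)) (node (k : Fin d → ℝ))‖ ≤
      1 / (5 * clusterComplexity N Ω) := by
  set c := clusterComplexity N Ω
  have hc : 1 ≤ c := one_le_clusterComplexity N ⟨j, j.2⟩
  have hN := h.pos
  have hN0 : (0 : ℝ) < N := Nat.cast_pos.2 hN
  have hd1 : (1 : ℝ) ≤ d := Nat.one_le_cast.2 hd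
  set Q : ℝ := (4 * c) ^ (1 / ((d : ℝ) + 1)) with hQ
  have hQ1 : 1 ≤ Q := Real.one_le_rpow (by linarith) (by positivity)
  have hQc : Q ^ (d + 1) = 4 * c := by
    rw [hQ, one_div, ← Nat.cast_add_one, Real.rpow_inv_natCast_pow (by positivity) (by omega)]
  have hsep (j k : Ω) (hjk : h.clusterIndex j ≠ h.clusterIndex k) :
      12 * d * Q / N ≤ wrapDist (j : Fin d → ℝ) k := by
    rw [div_le_iff₀' hN0]
    exact_mod_cast hρ.trans (h.clusterSep_le_of_clusterIndex_ne hjk)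
  rcases Finset.eq_empty_or_nonempty {k | h.clusterIndex j ≠ h.clusterIndex k} with hnone | ⟨k, hk⟩
  · rw [hnone, Finset.sum_empty]
    positivity
  have hN24 : 24 ≤ N := by
    have hhalf := (hsep j k (Finset.mem_filter.1 hk).2).trans (wrapDist_le_half _ _)
    rw [div_le_iff₀ hN0] at hhalf
    have : (24 : ℝ) ≤ N := by nlinarith
    exact_mod_cast this
  refine (sum_norm_torusKernel_localizer_le hd (by omega) hm' (s := 12 * d * Q / N) (by positivity)
    (fun l => (h.card_filter_clusterIndex_le l).trans hpair) hsep j).trans ?_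
  exact two_mul_one_add_pow_sub_one_le hd hc (by positivity) <|
    one_div_localizer_decay_le hd hm (hm'N hN24) (by positivity) hQc
      (mul_div_cancel₀ _ hN0.ne').symm (by positivity)

theorem norm_sq_le_norm_conjTranspose_mulVec_sq (h : IsClusteredConfiguration N Ω Λ)
    (hΩ : Ω.Nonempty) (hd : 1 ≤ d) (hN : 2 ≤ N) (hpair : maxClusterCard Λ ≤ 2)
    (hρ : ((12 * d * (4 * clusterComplexity N Ω) ^ (1 / ((d : ℝ) + 1)) : ℝ) : EReal) ≤
      clusterSep N Λ) (v : EuclideanSpace ℂ Ω) :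
    ‖v‖ ^ 2 ≤ 72 * (d : ℝ) ^ ((d : ℝ) / 2) * (2 / N) ^ d * clusterComplexity N Ω ^ 2 *
      ‖WithLp.toLp 2 ((monomialMatrix (fun t : Ω => node (t : Fin d → ℝ)) N)ᴴ *ᵥ v)‖ ^ 2 := by
  obtain ⟨m, m', M, hm, hm', hm'N, hM5, hM2, hdeg⟩ := exists_localizer_parameters hd hN
  have hc := one_le_clusterComplexity N hΩ
  set c := clusterComplexity N Ω
  have hcoeff (a : ℕ) : (localizer d m m').coeff a ≤ 2 / N := by
    refine (coeff_localizer_le d m hm' a).trans ?_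
    rw [div_le_div_iff₀ (Nat.cast_pos.2 (by omega)) (Nat.cast_pos.2 (by omega)), one_mul]
    exact_mod_cast hm
  refine (norm_sq_le_of_modulation (z := fun t : Ω => node (t : Fin d → ℝ))
    (cl := h.clusterIndex) (q := 2) (κ := 5 / 4 * c) (ε := 1 / (5 * c))
    (coeff_localizer_nonneg d m m') (eval_one_localizer d (by omega) hm') hcoeff
    ((Nat.add_le_add_right (natDegree_localizer_le d m m') M).trans_lt hdeg)
    (fun t i => norm_node (t : Fin d → ℝ) i)
    (fun l => (h.card_filter_clusterIndex_le l).trans hpair) (by positivity) (by positivity)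
    (by field_simp; norm_num) (h.exists_modulation hd hpair hM5 hM2)
    (h.sum_norm_torusKernel_le_one_div hd hpair hρ hm hm' hm'N) v).trans ?_
  gcongr ?_ * _
  have hinv : 1 / (5 * c) ≤ 1 / 5 := one_div_le_one_div_of_le (by norm_num) (by linarith)
  calc 8 * (5 / 4 * c) ^ 2 * (1 + d) * ((2 / N) ^ d * ((2 : ℕ) + 1 / (5 * c)))
      ≤ 8 * (5 / 4 * c) ^ 2 * (1 + d) * ((2 / N) ^ d * ((2 : ℕ) + 1 / 5)) := by gcongr
    _ = 55 / 2 * (1 + d) * (2 / N) ^ d * c ^ 2 := by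
      push_cast
      ring
    _ ≤ 72 * (d : ℝ) ^ ((d : ℝ) / 2) * (2 / N) ^ d * c ^ 2 := by
      gcongr ?_ * _ * _
      have hd1 : (1 : ℝ) ≤ d := Nat.one_le_cast.2 hd
      linarith [natCast_le_rpow_half hd]

end IsClusteredConfiguration

end ClusteredVandermonde

open ClusteredVandermonde in
theorem mainTheorem4_general (d n L : ℕ) (hd : 1 ≤ d) (hn : 1 ≤ n) (Ω : Finset (Fin d → ℝ))
    (hne : Ω.Nonempty) (Λ : Fin L → Finset (Fin d → ℝ))
    (hΩ : IsClusteredConfiguration (n + 1) Ω Λ) (hpair : maxClusterCard Λ ≤ 2)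
    (hρ : ((12 * (d : ℝ) * (4 * clusterComplexity (n + 1) Ω) ^ (1 / ((d : ℝ) + 1)) : ℝ) : EReal) ≤
      clusterSep (n + 1) Λ) :
    1 / clusterComplexity (n + 1) Ω * ((n + 1 : ℕ) : ℝ) ^ ((d : ℝ) / 2) /
        (12 * (2 : ℝ) ^ ((d : ℝ) / 2 - 1 / 2) * (d : ℝ) ^ ((d : ℝ) / 4)) ≤
      sigmaMin (vandermonde n Ω) := by
  have hc := one_le_clusterComplexity (n + 1) hne
  obtain ⟨t, ht⟩ := hne
  have : Nonempty {v : EuclideanSpace ℂ Ω // ‖v‖ = 1} :=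
    ⟨⟨EuclideanSpace.single ⟨t, ht⟩ 1, by simp⟩⟩
  refine le_ciInf fun ⟨v, hv⟩ => le_of_sq_le_sq ?_ (norm_nonneg _)
  have hmain := hΩ.norm_sq_le_norm_conjTranspose_mulVec_sq ⟨t, ht⟩ hd (by omega) hpair hρ v
  rw [hv, one_pow] at hmain
  rw [sq_mul_rpow_half_div_eq]
  calc _ = 1 / (72 * (d : ℝ) ^ ((d : ℝ) / 2) * (2 / (n + 1 : ℕ)) ^ d *
          clusterComplexity (n + 1) Ω ^ 2) := by
        rw [div_pow, div_pow]
        field_simp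
    _ ≤ _ := (div_le_iff₀' (by positivity)).2 hmain

theorem mainTheorem4 (d n L : ℕ) (hd : 1 ≤ d) (Ω : Finset (Fin d → ℝ))
    (hcard : Ω.card < (n + 1) ^ d)
    (Λ : Fin L → Finset (Fin d → ℝ))
    (hΩ : ClusteredVandermonde.IsClusteredConfiguration (n + 1) Ω Λ)
    (hpair : ClusteredVandermonde.maxClusterCard Λ = 2) :
    ClusteredVandermonde.clusterComplexity (n + 1) Ω =
        1 / ClusteredVandermonde.minSep (n + 1) Ω ∧
      (((12 * (d : ℝ) * (4 / ClusteredVandermonde.minSep (n + 1) Ω) ^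
            (1 / ((d : ℝ) + 1)) : ℝ) : EReal) ≤ ClusteredVandermonde.clusterSep (n + 1) Λ →
        ClusteredVandermonde.minSep (n + 1) Ω * ((n + 1 : ℕ) : ℝ) ^ ((d : ℝ) / 2) /
            (12 * (2 : ℝ) ^ ((d : ℝ) / 2 - 1 / 2) * (d : ℝ) ^ ((d : ℝ) / 4)) ≤
          ClusteredVandermonde.sigmaMin (ClusteredVandermonde.vandermonde n Ω)) := by
  obtain ⟨t, ht, -⟩ := hΩ.exists_pair hpair
  have hn : 1 ≤ n := by
    by_contra! hn
    have hpos : 0 < Ω.card := Finset.card_pos.2 ⟨t, ht⟩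
    simp only [Nat.lt_one_iff.1 hn, zero_add, one_pow] at hcard
    omega
  have h𝒞 := hΩ.clusterComplexity_eq hpair
  have hbound := mainTheorem4_general d n L hd hn Ω ⟨t, ht⟩ Λ hΩ hpair.le
  simp only [h𝒞, mul_one_div, one_div_one_div] at hbound
  exact ⟨h𝒞, hbound⟩
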